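/- Let $\alpha>2$, $0<\varphi\le 2\pi$, $\lambda>0$, and let $\Phi=\{x_i\}_{i\in\mathbb N}$ be a homogeneous Poisson point process on $\mathbb{R}^2$ with intensity $\lambda$. Let $(h_i)_{i\in\mathbb N}$ be i.i.d. almost surely positive random variables (channel gains), independent of $\Phi$, distributed as $h$ with $E[h^{2/\alpha}]<\infty$. Fix a receiver $x\in\mathbb{R}^2$ that hears exactly the nodes $x_i$ for which the angle in $[0,2\pi)$ from the horizontal axis to $x_i-x$ is at most $\varphi$. Let $z_1<z_2<\cdots$ be the values $z=\|x-x_i\|^{\alpha}/h_i$ of the heard nodes in increasing order, so that $I_k=z_k^{-1}$ is the $k$-th largest (dominant) interference power $h_i\|x-x_i\|^{-\alpha}$ at $x$. For $n\ge 1$ let $$\mathcal I(n)=\sum_{k=n+1}^{\infty} I_k=\sum_{k=n+1}^\infty z_k^{-1}$$ be the partial accumulative interference without the first $n$ dominant interferers. If $n+1>\alpha/2$, then $$E[\mathcal I(n)]=\frac{2}{\alpha-2}\left(\frac{E[h^{2/\alpha}]\,\varphi\,\lambda}{2}\right)^{\alpha/2}\frac{\Gamma(n+1-\alpha/2)}{\Gamma(n)}.$$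 In particular this mean is finite. -/

import Mathlib

open MeasureTheory ProbabilityTheory

noncomputable section

/-- The Euclidean plane. -/
abbrev Plane : Type := EuclideanSpace ℝ (Fin 2)

/-- The number of points of the (random) family `X 0 ω, X 1 ω, …` that lie in `B`. -/
def pointCount {Ω E : Type*} (X : ℕ → Ω → E) (B : Set E) (ω : Ω) : ℕ∞ :=
  {i : ℕ | X i ω ∈ B}.encard

/-- The random points `X 0, X 1, …` form a Poisson point process with intensity measure `Λ`:
the number of points in a set of finite intensity is Poisson distributed with parameter `Λ B`,
and the numbers of points in disjoint sets are independent. -/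
structure IsPoissonPointProcess {Ω E : Type*} [MeasurableSpace Ω] [MeasurableSpace E]
    (X : ℕ → Ω → E) (Λ : Measure E) (P : Measure Ω) : Prop where
  measurable_point : ∀ i, Measurable (X i)
  hasLaw_count : ∀ B : Set E, MeasurableSet B → Λ B ≠ ⊤ →
    HasLaw (pointCount X B) ((poissonMeasure (Λ B).toNNReal).map (Nat.cast : ℕ → ℕ∞)) P
  indep_count : ∀ (m : ℕ) (B : Fin m → Set E), (∀ j, MeasurableSet (B j)) →
    Pairwise (fun j k => Disjoint (B j) (B k)) → iIndepFun (fun j => pointCount X (B j)) P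

/-- The angle in `[0, 2π)` from the horizontal axis to the vector `v`. -/
def polarAngle (v : Plane) : ℝ :=
  toIcoMod Real.two_pi_pos 0 (Complex.arg ⟨v 0, v 1⟩)

/-- The (indices of the) nodes heard by a receiver at `x` with reception angle `φ`. -/
def receivedNodes (φ : ℝ) (x : Plane) (p : ℕ → Plane) : Set ℕ :=
  {i | polarAngle (p i - x) ≤ φ}

/-- The inverse interference power `‖x - pᵢ‖ ^ α / hᵢ` of node `i` at the receiver `x`. -/
def inversePower (α : ℝ) (x : Plane) (p : ℕ → Plane) (h : ℕ → ℝ) (i : ℕ) : ℝ :=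
  ‖x - p i‖ ^ α / h i

/-- The `n`-th smallest value (`n = 1, 2, …`) of the family `(z i)`, `i ∈ J`, i.e. the least `t`
for which at least `n` members of the family are `≤ t`. -/
def nthSmallest (J : Set ℕ) (z : ℕ → ℝ) (n : ℕ) : ℝ :=
  sInf {t : ℝ | (n : ℕ∞) ≤ {i ∈ J | z i ≤ t}.encard}

/-- If the family can be listed in strictly increasing order, then `nthSmallest` returns the
terms of that list. -/
theorem nthSmallest_eq_of_strictMono {J : Set ℕ} {z : ℕ → ℝ} {e : ℕ → ℕ}
    (he : Set.BijOn e Set.univ J) (hz : StrictMono fun k => z (e k)) (k : ℕ) :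
    nthSmallest J z (k + 1) = z (e k) := by
  have key : {t : ℝ | ((k + 1 : ℕ) : ℕ∞) ≤ {i ∈ J | z i ≤ t}.encard} = Set.Ici (z (e k)) := by
    ext t
    simp only [Set.mem_ofPred_eq, Set.mem_Ici]
    have himg : {i ∈ J | z i ≤ t} = e '' {j | z (e j) ≤ t} := by
      ext i
      constructor
      · rintro ⟨hi, hit⟩
        obtain ⟨j, -, rfl⟩ := he.surjOn hi
        exact ⟨j, hit, rfl⟩
      · rintro ⟨j, hj, rfl⟩
        exact ⟨he.mapsTo (Set.mem_univ j), hj⟩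
    have hinj : Function.Injective e := Set.injOn_univ.mp he.injOn
    rw [himg, hinj.encard_image]
    constructor
    · intro hk
      by_contra! hlt
      have hsub : {j | z (e j) ≤ t} ⊆ (Finset.range k : Set ℕ) := by
        intro j hj
        have : z (e j) < z (e k) := lt_of_le_of_lt hj hlt
        simpa using hz.lt_iff_lt.mp this
      have h1 := hk.trans (Set.encard_le_encard hsub)
      rw [Set.encard_coe_eq_coe_finsetCard, Finset.card_range, Nat.cast_le] at h1
      omega
    · intro hk
      have hsub : (Finset.range (k + 1) : Set ℕ) ⊆ {j | z (e j) ≤ t} := by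
        intro j hj
        have hj' : j ≤ k := by simpa [Nat.lt_succ_iff] using hj
        exact (hz.monotone hj').trans hk
      have h1 := Set.encard_le_encard hsub
      rwa [Set.encard_coe_eq_coe_finsetCard, Finset.card_range] at h1
  rw [nthSmallest, key, csInf_Ici]

/-- The `n`-th dominant interference power at `x` (`n = 1, 2, …`): the inverse of the `n`-th
smallest inverse power among the received nodes. -/
def dominantInterference (α φ : ℝ) (x : Plane) (p : ℕ → Plane) (h : ℕ → ℝ) (n : ℕ) : ℝ :=
  (nthSmallest (receivedNodes φ x p) (inversePower α x p h) n)⁻¹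

/-- The partial accumulative interference: the sum of all the dominant interference powers but
the first `n`, as an extended nonnegative number. -/
def partialInterference (α φ : ℝ) (x : Plane) (p : ℕ → Plane) (h : ℕ → ℝ) (n : ℕ) : ENNReal :=
  ∑' k : ℕ, ENNReal.ofReal (dominantInterference α φ x p h (n + 1 + k))

end

open MeasureTheory ProbabilityTheory

noncomputable section

open Filter Topology
open scoped ENNReal NNReal

/-! Let N(t) be the number of heard nodes with z ≤ t. By the marking theorem N(t) is Poisson with
mean c t^(2/α), where c = E[h^(2/α)] φ λ / 2: a node with gain m counts iff it lies in a sector of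
radius (tm)^(1/α). Since z_k ≤ t means N(t) ≥ k, up to a null set of t, the layer-cake identity
1/z_k = ∫ t^(-2) 1{N(t) ≥ k} dt reduces E[I_k] to the marginal laws of N(t); no joint law of the z_k
is needed.

Put a = α/2. The Poisson tail P(N ≥ k+1) at mean r is the integral over (0, r] of the mass at k, so
Tonelli gives E[I_(k+1)] = c^a ∫ P(N_u = k) u^(-a) du, with N_u Poisson of mean u. Summing over k ≥
n turns the point mass into the tail P(N_u ≥ n); the same tail formula and Tonelli again leave a
Gamma integral. All sums and integrals are in `ℝ≥0∞`, so finiteness comes out with the value.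

The marking theorem is proved through generating functions E[s^N], which determine laws on `ℕ∞`.
Averaging over the marks turns s^N into a product over points, evaluated by the Laplace functional
of the Poisson process (`IsPoissonPointProcess.lintegral_iInf_prod`). -/

/-! ### Weights s^N, infinite products and the Poisson generating function. -/

/-- The weight `s ^ N` for `s ≤ 1` and a possibly infinite exponent `N`. -/
def countWeight (s : ℝ≥0∞) (N : ℕ∞) : ℝ≥0∞ := ⨅ n : {n : ℕ // (n : ℕ∞) ≤ N}, s ^ (n : ℕ)

theorem countWeight_natCast {s : ℝ≥0∞} (hs : s ≤ 1) (k : ℕ) : countWeight s k = s ^ k := by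
  refine le_antisymm (iInf_le (fun n : {n : ℕ // (n : ℕ∞) ≤ k} => s ^ (n : ℕ)) ⟨k, le_rfl⟩) ?_
  refine le_iInf fun n => pow_le_pow_of_le_one zero_le hs ?_
  exact_mod_cast n.2

theorem countWeight_top {s : ℝ≥0∞} (hs : s < 1) : countWeight s ⊤ = 0 := by
  refine le_antisymm ?_ zero_le
  refine ge_of_tendsto' (ENNReal.tendsto_pow_atTop_nhds_zero_of_lt_one hs) fun n => ?_
  exact iInf_le (fun n : {n : ℕ // (n : ℕ∞) ≤ ⊤} => s ^ (n : ℕ)) ⟨n, le_top⟩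

theorem countWeight_one (N : ℕ∞) : countWeight 1 N = 1 := by
  have : Nonempty {n : ℕ // (n : ℕ∞) ≤ N} := ⟨⟨0, by simp⟩⟩
  simp [countWeight]

-- Partial products of factors at most 1 decrease, so an infinite product is the infimum of its
-- partial products; this also covers infinite S.
open Classical in
theorem iInf_prod_ite_mem {s : ℝ≥0∞} (hs : s ≤ 1) (S : Set ℕ) :
    ⨅ n, ∏ i ∈ Finset.range n, (if i ∈ S then s else 1) = countWeight s S.encard := by
  simp only [Finset.prod_ite, Finset.prod_const, one_pow, mul_one]
  apply le_antisymm
  · refine le_iInf fun ⟨k, hk⟩ => ?_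
    obtain ⟨t, htS, htk⟩ := Set.exists_subset_encard_eq hk
    have hfin : t.Finite := Set.finite_of_encard_eq_coe htk
    obtain ⟨F, rfl⟩ := hfin.exists_finset_coe
    rw [Set.encard_coe_eq_coe_finsetCard, Nat.cast_inj] at htk
    refine iInf_le_of_le (F.sup id + 1) (pow_le_pow_of_le_one zero_le hs ?_)
    refine htk.ge.trans (Finset.card_le_card fun i hi => ?_)
    simp only [Finset.mem_filter, Finset.mem_range]
    exact ⟨Nat.lt_succ_of_le (Finset.le_sup (f := id) hi), htS hi⟩
  · refine le_iInf fun n => ?_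
    refine iInf_le (fun n : {n : ℕ // (n : ℕ∞) ≤ S.encard} => s ^ (n : ℕ))
      ⟨((Finset.range n).filter (· ∈ S)).card, ?_⟩
    rw [← Set.encard_coe_eq_coe_finsetCard]
    exact Set.encard_le_encard fun i hi => by simpa using (Finset.mem_filter.mp hi).2

theorem antitone_prod_range {f : ℕ → ℝ≥0∞} (hf : ∀ i, f i ≤ 1) :
    Antitone fun n => ∏ i ∈ Finset.range n, f i :=
  antitone_nat_of_succ_le fun n => by
    rw [Finset.prod_range_succ]; exact mul_le_of_le_one_right' (hf n)

theorem prod_range_le_one {f : ℕ → ℝ≥0∞} (hf : ∀ i, f i ≤ 1) (n : ℕ) :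
    ∏ i ∈ Finset.range n, f i ≤ 1 := Finset.prod_le_one' fun i _ => hf i

theorem iInf_finsetProd_of_antitone {ι : Type*} (s : Finset ι) {f : ι → ℕ → ℝ≥0∞}
    (hf : ∀ y ∈ s, Antitone (f y)) (hf1 : ∀ y ∈ s, ∀ n, f y n ≤ 1) :
    ⨅ n, ∏ y ∈ s, f y n = ∏ y ∈ s, ⨅ n, f y n := by
  have h1 : Antitone fun n => ∏ y ∈ s, f y n := fun a b hab =>
    Finset.prod_le_prod' fun y hy => hf y hy hab
  refine tendsto_nhds_unique (tendsto_atTop_iInf h1) ?_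
  refine ENNReal.tendsto_finsetProd_of_ne_top _ (fun y hy => tendsto_atTop_iInf (hf y hy))
    fun y hy => ?_
  exact ((iInf_le _ 0).trans_lt ((hf1 y hy 0).trans_lt ENNReal.one_lt_top)).ne

/-- The probability generating function of the Poisson distribution. -/
theorem lintegral_countWeight_poissonMeasure {s : ℝ≥0∞} (hs : s ≤ 1) (r : ℝ≥0) :
    ∫⁻ N, countWeight s N ∂((poissonMeasure r).map (Nat.cast : ℕ → ℕ∞)) =
      ENNReal.ofReal (Real.exp (-((1 - s) * r).toReal)) := by
  have hs_top : s ≠ ⊤ := (hs.trans_lt ENNReal.one_lt_top).ne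
  lift s to ℝ≥0 using hs_top
  rw [lintegral_map .of_discrete .of_discrete, poissonMeasure, lintegral_sum_measure]
  simp only [lintegral_smul_measure, lintegral_dirac, countWeight_natCast hs, smul_eq_mul]
  have h1 : HasSum (fun n : ℕ => Real.exp (-r) * ((r * s : ℝ) ^ n / n.factorial))
      (Real.exp (-r) * Real.exp (r * s)) := by
    have := NormedSpace.expSeries_div_hasSum_exp (r * s : ℝ)
    rw [← Real.exp_eq_exp_ℝ] at this
    exact this.mul_left _
  have h2 : -((1 - s : ℝ≥0∞) * r).toReal = -r + r * s := by
    rw [ENNReal.toReal_mul, ENNReal.toReal_sub_of_le hs ENNReal.one_ne_top]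
    simp only [ENNReal.toReal_one, ENNReal.coe_toReal]; ring
  rw [h2, Real.exp_add, ← h1.tsum_eq, ENNReal.ofReal_tsum_of_nonneg (fun n => by positivity)
    h1.summable]
  congr with n
  rw [← ENNReal.ofReal_coe_nnreal (p := s), ← ENNReal.ofReal_pow (by positivity),
    ← ENNReal.ofReal_mul (by positivity)]
  congr 1
  rw [mul_pow]; ring

/-! ### Laplace functional of a Poisson point process. -/

section

variable {Ω E : Type*} [MeasurableSpace Ω] [MeasurableSpace E] {X : ℕ → Ω → E} {Λ : Measure E}
  {P : Measure Ω}

theorem measurable_pointCount (hX : ∀ i, Measurable (X i)) {B : Set E} (hB : MeasurableSet B) :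
    Measurable (pointCount X B) :=
  measurable_encard.comp (measurable_set_iff.2 fun i => measurable_mem.2 (hX i hB))

theorem IsPoissonPointProcess.lintegral_countWeight (hX : IsPoissonPointProcess X Λ P)
    {s : ℝ≥0∞} (hs : s ≤ 1) {B : Set E} (hB : MeasurableSet B) (hΛ : Λ B ≠ ⊤) :
    ∫⁻ ω, countWeight s (pointCount X B ω) ∂P =
      ENNReal.ofReal (Real.exp (-((1 - s) * Λ B).toReal)) := by
  have h := hX.hasLaw_count B hB hΛ
  rw [← lintegral_map' (f := countWeight s) .of_discrete h.aemeasurable, h.map_eq,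
    lintegral_countWeight_poissonMeasure hs, ENNReal.coe_toNNReal hΛ]

theorem IsPoissonPointProcess.iIndepFun_pointCount (hX : IsPoissonPointProcess X Λ P)
    {ι : Type*} [Finite ι] {B : ι → Set E} (hB : ∀ j, MeasurableSet (B j))
    (hd : Pairwise fun j k => Disjoint (B j) (B k)) :
    iIndepFun (fun j => pointCount X (B j)) P := by
  obtain ⟨m, ⟨e⟩⟩ := Finite.exists_equiv_fin ι
  have := hX.indep_count m (fun j => B (e.symm j)) (fun j => hB _)
    fun j k hjk => hd (e.symm.injective.ne hjk)
  simpa using this.precomp e.injective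

/-- The level sets of g are disjoint, so the product over points splits into independent weights (1
- y)^N, one per value y, each averaged by the Poisson generating function. -/
theorem IsPoissonPointProcess.lintegral_iInf_prod_simpleFunc (hX : IsPoissonPointProcess X Λ P)
    (g : SimpleFunc E ℝ≥0∞) (hg : ∀ p, g p ≤ 1) (hfin : ∫⁻ p, g p ∂Λ ≠ ⊤) :
    ∫⁻ ω, ⨅ n, ∏ i ∈ Finset.range n, (1 - g (X i ω)) ∂P =
      ENNReal.ofReal (Real.exp (-(∫⁻ p, g p ∂Λ).toReal)) := by
  classical
  have hsum : ∫⁻ p, g p ∂Λ = ∑ y : g.range, (y : ℝ≥0∞) * Λ (g ⁻¹' {(y : ℝ≥0∞)}) := by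
    rw [g.lintegral_eq_lintegral, SimpleFunc.lintegral,
      Finset.sum_coe_sort g.range fun y => y * Λ (g ⁻¹' {y})]
  have hy1 : ∀ y : g.range, (y : ℝ≥0∞) ≤ 1 := by
    rintro ⟨y, hy⟩
    obtain ⟨p, rfl⟩ := SimpleFunc.mem_range.1 hy
    exact hg p
  have hterm : ∀ y : g.range, (y : ℝ≥0∞) * Λ (g ⁻¹' {(y : ℝ≥0∞)}) ≠ ⊤ := by
    intro y
    rw [hsum] at hfin
    exact (ENNReal.sum_lt_top.1 hfin.lt_top y (Finset.mem_univ y)).ne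
  have hprod : ∀ ω, ⨅ n, ∏ i ∈ Finset.range n, (1 - g (X i ω)) =
      ∏ y : g.range, countWeight (1 - y) (pointCount X (g ⁻¹' {(y : ℝ≥0∞)}) ω) := by
    intro ω
    have h1 : ∀ i, (1 - g (X i ω)) = ∏ y : g.range,
        if i ∈ {i | X i ω ∈ g ⁻¹' {(y : ℝ≥0∞)}} then 1 - (y : ℝ≥0∞) else 1 := by
      intro i
      rw [Finset.prod_eq_single ⟨g (X i ω), g.mem_range_self _⟩]
      · simp
      · intro y _ hy
        rw [if_neg]
        intro h
        exact hy (Subtype.ext h.symm)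
      · simp
    simp only [h1]
    simp only [Finset.prod_comm (s := Finset.range _)]
    rw [iInf_finsetProd_of_antitone]
    · refine Finset.prod_congr rfl fun y _ => ?_
      exact iInf_prod_ite_mem tsub_le_self _
    · intro y _
      exact antitone_prod_range fun i => by split_ifs <;> simp
    · intro y _ n
      exact prod_range_le_one (fun i => by split_ifs <;> simp) n
  have hindep : iIndepFun (fun (y : g.range) ω =>
      countWeight (1 - y) (pointCount X (g ⁻¹' {(y : ℝ≥0∞)}) ω)) P := by
    refine iIndepFun.comp (hX.iIndepFun_pointCount (B := fun y : g.range => g ⁻¹' {(y : ℝ≥0∞)})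
      (fun y => g.measurableSet_preimage _) ?_) (fun y => countWeight (1 - y))
      fun y => .of_discrete
    intro y z hyz
    exact Disjoint.preimage _ (by simpa using fun h => hyz (Subtype.ext h))
  simp only [hprod]
  rw [lintegral_prod_eq_prod_lintegral_of_indepFun _ _ hindep fun y =>
    (Measurable.of_discrete (f := countWeight (1 - y))).comp
      (measurable_pointCount hX.measurable_point (g.measurableSet_preimage _)), hsum, ENNReal.toReal_sum fun y _ => hterm y,
    ← Finset.sum_neg_distrib, Real.exp_sum, ENNReal.ofReal_prod_of_nonneg fun _ _ => by positivity]
  refine Finset.prod_congr rfl fun y _ => ?_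
  have := hindep.isProbabilityMeasure
  -- The level set of 0 may have infinite intensity, but its weight is 1^N = 1. Every other level
  -- set has finite intensity because g is integrable.
  by_cases hy0 : (y : ℝ≥0∞) = 0
  · simp [hy0, countWeight_one]
  · rw [hX.lintegral_countWeight tsub_le_self (g.measurableSet_preimage _),
      ENNReal.sub_sub_cancel ENNReal.one_ne_top (hy1 y)]
    intro htop
    exact hterm y (by rw [htop, ENNReal.mul_top hy0])

/-- The Laplace functional of a Poisson point process, in multiplicative form. -/
theorem IsPoissonPointProcess.lintegral_iInf_prod (hX : IsPoissonPointProcess X Λ P)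
    [IsFiniteMeasure P] {q : E → ℝ≥0∞} (hq : Measurable q) (hq1 : ∀ p, q p ≤ 1)
    (hfin : ∫⁻ p, q p ∂Λ ≠ ⊤) :
    ∫⁻ ω, ⨅ n, ∏ i ∈ Finset.range n, (1 - q (X i ω)) ∂P =
      ENNReal.ofReal (Real.exp (-(∫⁻ p, q p ∂Λ).toReal)) := by
  have hle : ∀ m p, SimpleFunc.eapprox q m p ≤ q p := fun m p => by
    rw [← SimpleFunc.iSup_eapprox_apply hq p]; exact le_iSup (fun m => SimpleFunc.eapprox q m p) m
  have hI : ∀ m, ∫⁻ p, SimpleFunc.eapprox q m p ∂Λ ≤ ∫⁻ p, q p ∂Λ := fun m =>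
    lintegral_mono (hle m)
  have hXm := hX.measurable_point
  have hanti : ∀ p, Antitone fun m => 1 - SimpleFunc.eapprox q m p := fun p a b hab =>
    tsub_le_tsub_left (SimpleFunc.monotone_eapprox q hab p) 1
  have hlim : ∀ ω, ⨅ n, ∏ i ∈ Finset.range n, (1 - q (X i ω)) =
      ⨅ m, ⨅ n, ∏ i ∈ Finset.range n, (1 - SimpleFunc.eapprox q m (X i ω)) := by
    intro ω
    rw [iInf_comm]
    congr with n
    rw [iInf_finsetProd_of_antitone _ (fun i _ => hanti _) (fun i _ m => tsub_le_self)]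
    refine Finset.prod_congr rfl fun i _ => ?_
    rw [← SimpleFunc.iSup_eapprox_apply hq, ENNReal.sub_iSup ENNReal.one_ne_top]
  simp only [hlim]
  have hmono : Antitone fun m ω =>
      ⨅ n, ∏ i ∈ Finset.range n, (1 - SimpleFunc.eapprox q m (X i ω)) := fun a b hab ω =>
    iInf_mono fun n => Finset.prod_le_prod' fun i _ => hanti _ hab
  have hbound : ∀ m ω, ⨅ n, ∏ i ∈ Finset.range n, (1 - SimpleFunc.eapprox q m (X i ω)) ≤ 1 :=
    fun m ω => (iInf_le _ 0).trans (by simp)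
  -- Approximating q from below makes the products decrease; monotone convergence then needs one
  -- finite integral, supplied by the bound 1.
  rw [lintegral_iInf]
  · simp only [hX.lintegral_iInf_prod_simpleFunc _ (fun p => (hle _ p).trans (hq1 p))
      ((hI _).trans_lt hfin.lt_top).ne]
    refine tendsto_nhds_unique (tendsto_atTop_iInf fun a b hab => ?_) ?_
    · refine ENNReal.ofReal_le_ofReal (Real.exp_le_exp.2 (neg_le_neg ?_))
      exact ENNReal.toReal_mono ((hI _).trans_lt hfin.lt_top).ne
        (lintegral_mono (SimpleFunc.monotone_eapprox q hab))
    · refine ENNReal.tendsto_ofReal ((Real.continuous_exp.tendsto _).comp (Tendsto.neg ?_))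
      refine (ENNReal.tendsto_toReal hfin).comp ?_
      have : ∫⁻ p, q p ∂Λ = ⨆ m, ∫⁻ p, SimpleFunc.eapprox q m p ∂Λ := by
        rw [← lintegral_iSup (fun m => SimpleFunc.measurable _)
          fun a b hab => SimpleFunc.monotone_eapprox q hab]
        simp only [SimpleFunc.iSup_eapprox_apply hq]
      rw [this]
      exact tendsto_atTop_iSup fun a b hab =>
        lintegral_mono (SimpleFunc.monotone_eapprox q hab)
  · intro m
    exact .iInf fun n => Finset.measurable_prod _ fun i _ =>
      (measurable_const.sub ((SimpleFunc.measurable _).comp (hXm i)))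
  · exact hmono
  · exact ((lintegral_mono (hbound 0)).trans_lt (by simp)).ne

end

/-! ### Generating functions determine laws on `ℕ∞`. -/

theorem eq_zero_of_hasSum_mul_pow_eq_zero {c : ℕ → ℝ} (hc : ∀ k, |c k| ≤ 1)
    (h : ∀ s : ℝ, 0 < s → s < 1 → HasSum (fun k => c k * s ^ k) 0) (k : ℕ) : c k = 0 := by
  induction k using Nat.strong_induction_on with
  | _ k ih =>
  by_contra hk
  have hpos : 0 < |c k| := abs_pos.2 hk
  -- At the first nonzero coefficient, the geometric bound on the tail gives |c k| (1 - s) ≤ s. Here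
  -- s = |c k| / 4 ≤ 1/4, which makes this impossible.
  set s : ℝ := |c k| / 4 with hs
  have hs0 : 0 < s := by positivity
  have hs1 : s < 1 := by have := hc k; linarith
  have h1 := (hasSum_nat_add_iff' (k + 1)).2 (h s hs0 hs1)
  rw [Finset.sum_range_succ, Finset.sum_eq_zero (fun j hj => by
    rw [ih j (Finset.mem_range.1 hj), zero_mul])] at h1
  have h2 : HasSum (fun j : ℕ => s ^ (k + 1) * s ^ j) (s ^ (k + 1) * (1 - s)⁻¹) :=
    (hasSum_geometric_of_lt_one hs0.le hs1).mul_left _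
  have h3 : |0 - (0 + c k * s ^ k)| ≤ s ^ (k + 1) * (1 - s)⁻¹ := by
    rw [← h1.tsum_eq, ← Real.norm_eq_abs]
    refine tsum_of_norm_bounded h2 fun j => ?_
    rw [norm_mul, Real.norm_eq_abs, norm_pow, Real.norm_of_nonneg hs0.le,
      show s ^ (j + (k + 1)) = s ^ (k + 1) * s ^ j by ring]
    exact mul_le_of_le_one_left (by positivity) (hc _)
  rw [zero_add, zero_sub, abs_neg, abs_mul, abs_of_pos (pow_pos hs0 k), pow_succ, mul_assoc,
    mul_comm, mul_le_mul_iff_right₀ (pow_pos hs0 k), ← div_eq_mul_inv,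
    le_div_iff₀ (by linarith)] at h3
  have := hc k
  nlinarith

theorem lintegral_countWeight_eq_tsum (μ : Measure ℕ∞) {s : ℝ≥0∞} (hs : s < 1) :
    ∫⁻ N, countWeight s N ∂μ = ∑' k : ℕ, s ^ k * μ {(k : ℕ∞)} := by
  rw [lintegral_countable']
  have hinj : Function.Injective (Nat.cast : ℕ → ℕ∞) := Nat.cast_injective
  rw [← hinj.tsum_eq]
  · simp only [countWeight_natCast hs.le]
  · intro N hN
    induction N using ENat.recTopCoe with
    | top => simp [countWeight_top hs] at hN
    | coe k => exact ⟨k, rfl⟩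

/-- A distribution on `ℕ∞` is determined by its probability generating function. -/
theorem ext_of_lintegral_countWeight {μ ν : Measure ℕ∞} [IsProbabilityMeasure μ]
    [IsProbabilityMeasure ν]
    (h : ∀ s < 1, ∫⁻ N, countWeight s N ∂μ = ∫⁻ N, countWeight s N ∂ν) : μ = ν := by
  have hsum : ∀ (ρ : Measure ℕ∞) [IsProbabilityMeasure ρ] (s : ℝ), 0 < s → s < 1 →
      HasSum (fun k : ℕ => ρ.real {(k : ℕ∞)} * s ^ k)
        (∫⁻ N, countWeight (ENNReal.ofReal s) N ∂ρ).toReal := by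
    intro ρ _ s hs0 hs1
    have hs1' : ENNReal.ofReal s < 1 := by simpa using hs1
    have hle : ∫⁻ N, countWeight (ENNReal.ofReal s) N ∂ρ ≤ 1 := by
      refine (lintegral_mono (g := fun _ => 1) fun N => ?_).trans (by simp)
      exact (iInf_le (fun n : {n : ℕ // (n : ℕ∞) ≤ N} => ENNReal.ofReal s ^ (n : ℕ))
        ⟨0, by simp⟩).trans (by simp)
    have hne := (hle.trans_lt ENNReal.one_lt_top).ne
    rw [lintegral_countWeight_eq_tsum _ hs1'] at hne ⊢
    rw [ENNReal.tsum_toReal_eq (ENNReal.ne_top_of_tsum_ne_top hne)]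
    convert! ENNReal.hasSum_toReal hne using 2 with k
    rw [ENNReal.toReal_mul, ENNReal.toReal_pow, ENNReal.toReal_ofReal hs0.le, mul_comm]
    rfl
  have hnat : ∀ k : ℕ, μ {(k : ℕ∞)} = ν {(k : ℕ∞)} := by
    intro k
    have := eq_zero_of_hasSum_mul_pow_eq_zero
      (c := fun k : ℕ => μ.real {(k : ℕ∞)} - ν.real {(k : ℕ∞)}) (fun k => ?_)
      (fun s hs0 hs1 => ?_) k
    · exact (measureReal_eq_measureReal_iff).1 (sub_eq_zero.1 this)
    · rw [abs_le]
      constructor <;>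
      linarith [measureReal_nonneg (μ := μ) (s := {(k : ℕ∞)}),
        measureReal_nonneg (μ := ν) (s := {(k : ℕ∞)}),
        measureReal_le_one (μ := μ) (s := {(k : ℕ∞)}),
        measureReal_le_one (μ := ν) (s := {(k : ℕ∞)})]
    · have := (hsum μ s hs0 hs1).sub (hsum ν s hs0 hs1)
      rw [h _ (by simpa using hs1), sub_self] at this
      simpa only [sub_mul] using this
  refine Measure.ext_of_singleton fun N => ?_
  induction N using ENat.recTopCoe with
  | coe k => exact hnat k
  | top =>
    -- For s < 1 the weight vanishes at ⊤, so the mass there is recovered from total mass 1.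
    have hc : ({⊤} : Set ℕ∞) = (⋃ k : ℕ, {(k : ℕ∞)})ᶜ := by
      ext N
      induction N using ENat.recTopCoe <;> simp
    have hd : Pairwise (Function.onFun Disjoint fun k : ℕ => ({(k : ℕ∞)} : Set ℕ∞)) :=
      fun j k hjk => by simpa using hjk
    rw [hc, prob_compl_eq_one_sub (.of_discrete), prob_compl_eq_one_sub (.of_discrete),
      measure_iUnion hd fun _ => .of_discrete, measure_iUnion hd fun _ => .of_discrete]
    simp only [hnat]

/-! ### The marking theorem. -/

section

variable {Ω E F : Type*} [MeasurableSpace Ω] [MeasurableSpace E] [MeasurableSpace F]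
  {X : ℕ → Ω → E} {h : ℕ → Ω → F} {Λ : Measure E} {P : Measure Ω}

open Classical in
theorem lintegral_ite_mem_eq (μ : Measure F) [IsProbabilityMeasure μ] {B : Set F}
    (hB : MeasurableSet B) {s : ℝ≥0∞} (hs : s ≤ 1) :
    ∫⁻ y, (if y ∈ B then s else 1) ∂μ = 1 - (1 - s) * μ B := by
  have h1 : ∀ y, (if y ∈ B then s else 1) = 1 - B.indicator (fun _ => 1 - s) y := fun y => by
    by_cases hy : y ∈ B
    · simp [hy, ENNReal.sub_sub_cancel ENNReal.one_ne_top hs]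
    · simp [hy]
  simp only [h1]
  have h2 : ∫⁻ y, B.indicator (fun _ => 1 - s) y ∂μ = (1 - s) * μ B :=
    lintegral_indicator_const hB _
  rw [lintegral_sub (measurable_const.indicator hB), h2]
  · simp
  · rw [h2]
    exact ENNReal.mul_ne_top (tsub_le_self.trans_lt ENNReal.one_lt_top).ne (measure_ne_top _ _)
  · exact ae_of_all _ fun y => by
      by_cases hy : y ∈ B <;> simp [hy]

-- With the positions p frozen, the marks are independent, so each point contributes its own mean
-- factor.
open Classical in
theorem lintegral_iInf_prod_ite_of_iIndepFun [IsProbabilityMeasure P]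
    (h_meas : ∀ i, Measurable (h i)) (h_indep : iIndepFun h P)
    (h_ident : ∀ i, IdentDistrib (h i) (h 0) P P) {A : Set (E × F)} (hA : MeasurableSet A)
    {s : ℝ≥0∞} (hs : s ≤ 1) (p : ℕ → E) :
    ∫⁻ ω, ⨅ n, ∏ i ∈ Finset.range n, (if (p i, h i ω) ∈ A then s else 1) ∂P =
      ⨅ n, ∏ i ∈ Finset.range n, (1 - (1 - s) * P.map (h 0) (Prod.mk (p i) ⁻¹' A)) := by
  have hA' : ∀ i, MeasurableSet (Prod.mk (p i) ⁻¹' A) := fun i => measurable_prodMk_left hA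
  have hm : ∀ i, Measurable fun y => if y ∈ Prod.mk (p i) ⁻¹' A then s else 1 := fun i =>
    Measurable.ite (hA' i) measurable_const measurable_const
  have hm' : ∀ i, Measurable fun ω => if (p i, h i ω) ∈ A then s else 1 := fun i =>
    (hm i).comp (h_meas i)
  have : IsProbabilityMeasure (P.map (h 0)) :=
    Measure.isProbabilityMeasure_map (h_meas 0).aemeasurable
  rw [lintegral_iInf]
  · congr with n
    rw [lintegral_prod_eq_prod_lintegral_of_indepFun _
      (fun i ω => if (p i, h i ω) ∈ A then s else 1) ?_ hm']
    · refine Finset.prod_congr rfl fun i _ => ?_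
      rw [← lintegral_ite_mem_eq _ (hA' i) hs, ← (h_ident i).map_eq,
        lintegral_map (hm i) (h_meas i)]
      rfl
    · exact h_indep.comp (fun i y => if y ∈ Prod.mk (p i) ⁻¹' A then s else 1) hm
  · exact fun n => Finset.measurable_prod _ fun i _ => hm' i
  · exact fun a b hab ω => antitone_prod_range
      (f := fun i => if (p i, h i ω) ∈ A then s else 1) (fun i => by split_ifs <;> simp [hs]) hab
  · simp

/-- The marking theorem: if the points of a Poisson point process carry i.i.d. marks, then the
number of marked points in a set of finite intensity is Poisson distributed. -/
theorem IsPoissonPointProcess.hasLaw_pointCount_mark [IsProbabilityMeasure P]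
    (hX : IsPoissonPointProcess X Λ P)
    (h_meas : ∀ i, Measurable (h i)) (h_indep : iIndepFun h P)
    (h_ident : ∀ i, IdentDistrib (h i) (h 0) P P)
    (hXh : IndepFun (fun ω i => X i ω) (fun ω i => h i ω) P)
    {A : Set (E × F)} (hA : MeasurableSet A) (hfin : Λ.prod (P.map (h 0)) A ≠ ⊤) :
    HasLaw (pointCount (fun i ω => (X i ω, h i ω)) A)
      ((poissonMeasure (Λ.prod (P.map (h 0)) A).toNNReal).map (Nat.cast : ℕ → ℕ∞)) P := by
  classical
  have hXm := hX.measurable_point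
  have hcount : Measurable (pointCount (fun i ω => (X i ω, h i ω)) A) :=
    measurable_pointCount (fun i => (hXm i).prodMk (h_meas i)) hA
  refine ⟨hcount.aemeasurable, ?_⟩
  have : IsProbabilityMeasure (P.map (h 0)) :=
    Measure.isProbabilityMeasure_map (h_meas 0).aemeasurable
  have : IsProbabilityMeasure (P.map (pointCount (fun i ω => (X i ω, h i ω)) A)) :=
    Measure.isProbabilityMeasure_map hcount.aemeasurable
  refine ext_of_lintegral_countWeight fun s hs => ?_
  have hXm' : Measurable fun ω i => X i ω := measurable_pi_lambda _ hXm
  have hhm' : Measurable fun ω i => h i ω := measurable_pi_lambda _ h_meas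
  let G : (ℕ → E) × (ℕ → F) → ℝ≥0∞ := fun z =>
    ⨅ n, ∏ i ∈ Finset.range n, (if (z.1 i, z.2 i) ∈ A then s else 1)
  have hG : Measurable G := .iInf fun n => Finset.measurable_prod _ fun i _ =>
    Measurable.ite ((((measurable_pi_apply i).comp measurable_fst).prodMk
      ((measurable_pi_apply i).comp measurable_snd)) hA) measurable_const measurable_const
  have hQ : Measurable fun p => P.map (h 0) (Prod.mk p ⁻¹' A) := measurable_measure_prodMk_left hA
  have hQ' : Measurable fun p => (1 - s) * P.map (h 0) (Prod.mk p ⁻¹' A) := hQ.const_mul _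
  -- The marks thin the process: the Laplace functional is applied to q(p) = (1 - s) · (probability
  -- that a mark at p falls in A).
  have hQint : ∫⁻ p, (1 - s) * P.map (h 0) (Prod.mk p ⁻¹' A) ∂Λ =
      (1 - s) * Λ.prod (P.map (h 0)) A := by
    rw [lintegral_const_mul _ hQ, Measure.prod_apply hA]
  rw [lintegral_countWeight_poissonMeasure hs.le, ENNReal.coe_toNNReal hfin, ← hQint,
    ← hX.lintegral_iInf_prod hQ' (fun p => mul_le_one' tsub_le_self prob_le_one) ?_,
    lintegral_map .of_discrete hcount]
  · calc ∫⁻ ω, countWeight s (pointCount (fun i ω => (X i ω, h i ω)) A ω) ∂P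
        = ∫⁻ ω, G (fun i => X i ω, fun i => h i ω) ∂P :=
          lintegral_congr fun ω => (iInf_prod_ite_mem hs.le _).symm
      -- Independence of positions and marks makes their joint law a product, so the marks can be
      -- integrated first.
      _ = ∫⁻ p, ∫⁻ y, G (p, y) ∂(P.map fun ω i => h i ω) ∂(P.map fun ω i => X i ω) := by
          have hprod := (indepFun_iff_map_prod_eq_prod_map_map hXm'.aemeasurable
            hhm'.aemeasurable).1 hXh
          rw [← lintegral_prod _ hG.aemeasurable, ← hprod, lintegral_map hG (hXm'.prodMk hhm')]
      _ = ∫⁻ ω, ∫⁻ y, G (fun i => X i ω, y) ∂(P.map fun ω i => h i ω) ∂P := by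
          rw [lintegral_map hG.lintegral_prod_right' hXm']
      _ = _ := lintegral_congr fun ω => by
          rw [lintegral_map (f := fun y => G (fun i => X i ω, y))
            (hG.comp measurable_prodMk_left) hhm',
            ← lintegral_iInf_prod_ite_of_iIndepFun h_meas h_indep h_ident hA hs.le]
  · rw [hQint]
    exact ENNReal.mul_ne_top (tsub_le_self.trans_lt ENNReal.one_lt_top).ne hfin

end

/-! ### Sector areas and the mean measure of the heard region. -/

theorem toIcoMod_zero_arg (z : ℂ) :
    toIcoMod Real.two_pi_pos 0 z.arg = if 0 ≤ z.arg then z.arg else z.arg + 2 * Real.pi := by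
  have h1 := Complex.neg_pi_lt_arg z
  have h2 := Complex.arg_le_pi z
  have h3 := Real.pi_pos
  split_ifs with h
  · rw [toIcoMod_eq_self]
    exact ⟨h, by linarith⟩
  · rw [← toIcoMod_add_right, toIcoMod_eq_self]
    exact ⟨by linarith, by push Not at h; linarith⟩

theorem measurable_polarAngle : Measurable polarAngle := by
  have h1 : Measurable fun v : Plane => Complex.arg ⟨v 0, v 1⟩ := by
    refine Complex.measurable_arg.comp ?_
    have : (fun v : Plane => (⟨v 0, v 1⟩ : ℂ)) = fun v : Plane => (v 0 : ℂ) + v 1 * Complex.I := by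
      ext v
      exact Complex.mk_eq_add_mul_I _ _
    rw [this]
    fun_prop
  unfold polarAngle
  simp only [toIcoMod_zero_arg]
  exact Measurable.ite (measurableSet_le measurable_const h1) h1 (h1.add_const _)

theorem volume_angle_le {φ : ℝ} (hφ_le : φ ≤ 2 * Real.pi) :
    volume ({θ : ℝ | (if 0 ≤ θ then θ else θ + 2 * Real.pi) ≤ φ} ∩ Set.Ioo (-Real.pi) Real.pi) =
      ENNReal.ofReal φ := by
  have hpi := Real.pi_pos
  rcases le_or_gt φ Real.pi with h | h
  · apply le_antisymm
    · rw [← sub_zero φ, ← Real.volume_Icc]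
      refine measure_mono ?_
      rintro θ ⟨h1, h2, h3⟩
      simp only [Set.mem_ofPred_eq] at h1
      split_ifs at h1 with h0
      · exact ⟨h0, by linarith⟩
      · linarith
    · rw [← sub_zero φ, ← Real.volume_Ico]
      refine measure_mono ?_
      rintro θ ⟨h1, h2⟩
      refine ⟨?_, by linarith, by linarith⟩
      simp only [Set.mem_ofPred_eq, if_pos h1]
      linarith
  -- Beyond π the sector wraps around the branch cut of `Complex.arg`. For φ = 2π the second
  -- interval reaches 0, already in the first, hence the removal of `{0}`.
  · have hset : {θ : ℝ | (if 0 ≤ θ then θ else θ + 2 * Real.pi) ≤ φ} ∩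
        Set.Ioo (-Real.pi) Real.pi =
        Set.Ico 0 Real.pi ∪ (Set.Ioc (-Real.pi) (φ - 2 * Real.pi) \ {0}) := by
      ext θ
      simp only [Set.mem_inter_iff, Set.mem_ofPred_eq, Set.mem_Ioo, Set.mem_union, Set.mem_Ico,
        Set.mem_sdiff, Set.mem_Ioc, Set.mem_singleton_iff]
      constructor
      · rintro ⟨h1, h2, h3⟩
        split_ifs at h1 with h0
        · exact Or.inl ⟨h0, h3⟩
        · push Not at h0
          exact Or.inr ⟨⟨h2, by linarith⟩, h0.ne⟩
      · rintro (⟨h1, h2⟩ | ⟨⟨h1, h2⟩, h3⟩)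
        · rw [if_pos h1]
          exact ⟨by linarith, by linarith, h2⟩
        · have h4 : θ < 0 := lt_of_le_of_ne (by linarith) h3
          rw [if_neg (by linarith)]
          exact ⟨by linarith, h1, by linarith⟩
    rw [hset, measure_union _ (measurableSet_Ioc.diff (measurableSet_singleton _)),
      measure_sdiff_null (by simp), Real.volume_Ico, Real.volume_Ioc,
      ← ENNReal.ofReal_add (by linarith) (by linarith)]
    · congr 1; ring
    · rw [Set.disjoint_left]
      rintro θ ⟨h1, _⟩ ⟨⟨_, h2⟩, h3⟩
      exact h3 (le_antisymm (by linarith) h1)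

/-- The area of a circular sector. -/
theorem volume_sector {φ r : ℝ} (hφ_le : φ ≤ 2 * Real.pi) (hr : 0 ≤ r) :
    volume {v : Plane | polarAngle v ≤ φ ∧ ‖v‖ ≤ r} = ENNReal.ofReal (φ * r ^ 2 / 2) := by
  have hm : MeasurableSet {v : Plane | polarAngle v ≤ φ ∧ ‖v‖ ≤ r} :=
    (measurableSet_le measurable_polarAngle measurable_const).inter
      (measurableSet_le measurable_norm measurable_const)
  have hmp := Complex.orthonormalBasisOneI.measurePreserving_repr
  rw [← hmp.measure_preimage hm.nullMeasurableSet]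
  set S : Set ℂ := Complex.orthonormalBasisOneI.repr ⁻¹' {v : Plane | polarAngle v ≤ φ ∧ ‖v‖ ≤ r}
    with hS
  have hSm : MeasurableSet S := hmp.measurable hm
  have hmem : ∀ z : ℂ, z ∈ S ↔
      (if 0 ≤ z.arg then z.arg else z.arg + 2 * Real.pi) ≤ φ ∧ ‖z‖ ≤ r := by
    intro z
    rw [← toIcoMod_zero_arg, hS, Set.mem_preimage, Set.mem_ofPred_eq, LinearIsometryEquiv.norm_map,
      polarAngle]
    simp [Complex.orthonormalBasisOneI_repr_apply]
  rw [← lintegral_indicator_one hSm, ← Complex.lintegral_comp_polarCoord_symm]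
  set Θ : Set ℝ := {θ : ℝ | (if 0 ≤ θ then θ else θ + 2 * Real.pi) ≤ φ} with hΘ
  have hΘm : MeasurableSet Θ := measurableSet_le
    (Measurable.ite (measurableSet_le measurable_const measurable_id) measurable_id
      (measurable_id.add_const _)) measurable_const
  have hcongr : ∀ p ∈ polarCoord.target,
      ENNReal.ofReal p.1 • S.indicator (1 : ℂ → ℝ≥0∞) (Complex.polarCoord.symm p) =
      (Set.Iic r).indicator ENNReal.ofReal p.1 * Θ.indicator 1 p.2 := by
    intro p hp
    rw [polarCoord_target] at hp
    obtain ⟨hp1, hp2⟩ := hp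
    have hp1' : 0 < p.1 := hp1
    have harg : (Complex.polarCoord.symm p).arg = p.2 := by
      rw [Complex.polarCoord_symm_apply, Complex.ofReal_cos, Complex.ofReal_sin,
        Complex.arg_mul_cos_add_sin_mul_I hp1' ⟨hp2.1, hp2.2.le⟩]
    have hnorm : ‖Complex.polarCoord.symm p‖ = p.1 := by
      rw [Complex.norm_polarCoord_symm, abs_of_pos hp1']
    have hiff : Complex.polarCoord.symm p ∈ S ↔ p.1 ∈ Set.Iic r ∧ p.2 ∈ Θ := by
      rw [hmem, harg, hnorm, and_comm]; rfl
    by_cases h1 : p.1 ∈ Set.Iic r <;> by_cases h2 : p.2 ∈ Θ <;>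
      simp only [Set.indicator, hiff, h1, h2] <;> simp
  have htm : MeasurableSet polarCoord.target := polarCoord.open_target.measurableSet
  rw [setLIntegral_congr_fun htm hcongr, polarCoord_target, Measure.volume_eq_prod,
    ← Measure.prod_restrict, lintegral_prod_mul
      (ENNReal.measurable_ofReal.indicator measurableSet_Iic).aemeasurable
      (measurable_one.indicator hΘm).aemeasurable, lintegral_indicator_one hΘm,
    Measure.restrict_apply hΘm, volume_angle_le hφ_le,
    lintegral_indicator measurableSet_Iic, Measure.restrict_restrict measurableSet_Iic,
    Set.inter_comm, Set.Ioi_inter_Iic, ← ofReal_integral_eq_lintegral_ofReal,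
    ← intervalIntegral.integral_of_le hr, integral_id, ← ENNReal.ofReal_mul]
  · congr 1; ring
  · ring_nf; positivity
  · exact (continuous_id.integrableOn_Icc (μ := volume) (a := 0) (b := r)).mono_set
      Set.Ioc_subset_Icc_self
  · filter_upwards [ae_restrict_mem measurableSet_Ioc] with y hy using hy.1.le

/-- The marked points that are heard by a receiver at `x` with inverse power at most `t`. -/
def heardRegion (α φ : ℝ) (x : Plane) (t : ℝ) : Set (Plane × ℝ) :=
  {z | polarAngle (z.1 - x) ≤ φ ∧ ‖x - z.1‖ ^ α / z.2 ≤ t}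

theorem measurableSet_heardRegion_prod (α φ : ℝ) (x : Plane) :
    MeasurableSet {z : ℝ × (Plane × ℝ) | z.2 ∈ heardRegion α φ x z.1} := by
  have h1 : Measurable fun z : ℝ × (Plane × ℝ) => polarAngle (z.2.1 - x) :=
    measurable_polarAngle.comp (by fun_prop)
  have h2 : Measurable fun z : ℝ × (Plane × ℝ) => ‖x - z.2.1‖ ^ α / z.2.2 := by fun_prop
  exact (measurableSet_le h1 measurable_const).inter (measurableSet_le h2 measurable_fst)

theorem measurableSet_heardRegion (α φ : ℝ) (x : Plane) (t : ℝ) :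
    MeasurableSet (heardRegion α φ x t) :=
  measurable_prodMk_left (x := t) (measurableSet_heardRegion_prod α φ x)

/-- The slice at mark m is a translated sector of radius (tm)^(1/α), hence of area φ (tm)^(2/α) / 2;
only the moment of order 2/α enters. -/
theorem prod_heardRegion {α φ lam : ℝ} (hα : 0 < α) (hφ_pos : 0 < φ) (hφ_le : φ ≤ 2 * Real.pi)
    (x : Plane) (μ : Measure ℝ) [SFinite μ] (hμ : ∀ᵐ m ∂μ, 0 < m)
    (hint : Integrable (fun m : ℝ => m ^ (2 / α)) μ) {t : ℝ} (ht : 0 ≤ t) :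
    (ENNReal.ofReal lam • (volume : Measure Plane)).prod μ (heardRegion α φ x t) =
      ENNReal.ofReal ((∫ m, m ^ (2 / α) ∂μ) * φ * lam / 2 * t ^ (2 / α)) := by
  rw [Measure.prod_apply_symm (measurableSet_heardRegion α φ x t)]
  have hslice : ∀ m : ℝ, 0 < m →
      (ENNReal.ofReal lam • (volume : Measure Plane)) ((fun p => (p, m)) ⁻¹' heardRegion α φ x t) =
      ENNReal.ofReal (φ * t ^ (2 / α) / 2) * ENNReal.ofReal lam * ENNReal.ofReal (m ^ (2 / α)) := by
    intro m hm
    have hset : (fun p => (p, m)) ⁻¹' heardRegion α φ x t =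
        (fun p => p + -x) ⁻¹' {v : Plane | polarAngle v ≤ φ ∧ ‖v‖ ≤ (t * m) ^ α⁻¹} := by
      ext p
      simp only [heardRegion, Set.mem_preimage, Set.mem_ofPred_eq, ← sub_eq_add_neg]
      rw [div_le_iff₀ hm, norm_sub_rev,
        Real.le_rpow_inv_iff_of_pos (norm_nonneg _) (by positivity) hα]
    have hrp : φ * ((t * m) ^ α⁻¹) ^ 2 / 2 = φ * t ^ (2 / α) / 2 * m ^ (2 / α) := by
      rw [← Real.rpow_natCast, ← Real.rpow_mul (by positivity), Real.mul_rpow ht hm.le,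
        show α⁻¹ * ((2 : ℕ) : ℝ) = 2 / α by push_cast; ring]
      ring
    rw [hset, Measure.smul_apply, measure_preimage_add_right, volume_sector hφ_le (by positivity),
      hrp, ENNReal.ofReal_mul (by positivity), smul_eq_mul]
    ring
  rw [lintegral_congr_ae (hμ.mono fun m hm => hslice m hm), lintegral_const_mul' _ _
    (ENNReal.mul_ne_top ENNReal.ofReal_ne_top ENNReal.ofReal_ne_top),
    ← ofReal_integral_eq_lintegral_ofReal hint (hμ.mono fun m hm => by positivity)]
  have hI : 0 ≤ ∫ m, m ^ (2 / α) ∂μ := integral_nonneg_of_ae (hμ.mono fun m hm => by positivity)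
  rw [mul_assoc, ← ENNReal.ofReal_mul' hI, ← ENNReal.ofReal_mul (by positivity)]
  congr 1
  ring

/-! ### Layer-cake formula and Poisson tail integrals. -/

theorem setLIntegral_Ici_rpow {b s : ℝ} (hb : 0 < b) (hs : 1 < s) :
    ∫⁻ t in Set.Ici b, ENNReal.ofReal (t ^ (-s)) = ENNReal.ofReal (b ^ (1 - s) / (s - 1)) := by
  rw [setLIntegral_congr Ioi_ae_eq_Ici.symm, ← ofReal_integral_eq_lintegral_ofReal,
    integral_Ioi_rpow_of_lt (by linarith) hb]
  · congr 1
    rw [show -s + 1 = -(s - 1) by ring, neg_div_neg_eq, neg_sub]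
  · exact integrableOn_Ioi_rpow_of_lt (by linarith) hb
  · filter_upwards [ae_restrict_mem measurableSet_Ioi] with t ht
    exact Real.rpow_nonneg (hb.trans ht).le _

/-- S is a half-line from its infimum z, up to the endpoint, and 1/z is the integral of t^(-2)
beyond z. The point ε forces z > 0; at z = 0 the left side would be 0 (as `0⁻¹ = 0`) and the right
side infinite. -/
theorem ofReal_inv_sInf_eq_lintegral {S : Set ℝ} (hup : IsUpperSet S) (hne : S.Nonempty) {ε : ℝ}
    (hε : 0 < ε) (hεS : ε ∉ S) :
    ENNReal.ofReal (sInf S)⁻¹ =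
      ∫⁻ t in Set.Ioi 0, S.indicator (fun t => ENNReal.ofReal (t ^ (-2 : ℝ))) t := by
  have hlb : ∀ t ∈ S, ε ≤ t := fun t ht => by
    by_contra! h
    exact hεS (hup h.le ht)
  have hle : ε ≤ sInf S := le_csInf hne hlb
  have hpos : 0 < sInf S := hε.trans_le hle
  have hsub : Set.Ioi (sInf S) ⊆ S := fun t ht => by
    obtain ⟨u, hu, hut⟩ := exists_lt_of_csInf_lt hne ht
    exact hup hut.le hu
  have hsub' : S ⊆ Set.Ici (sInf S) := fun t ht => csInf_le ⟨ε, hlb⟩ ht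
  have hae : S =ᵐ[volume] Set.Ici (sInf S) :=
    (hsub'.eventuallyLE).antisymm (Ioi_ae_eq_Ici.symm.le.trans hsub.eventuallyLE)
  have hmeas : MeasurableSet S := hup.ordConnected.measurableSet
  have hinter : S ∩ Set.Ioi 0 = S := Set.inter_eq_left.2 fun t ht => hε.trans_le (hlb t ht)
  rw [lintegral_indicator hmeas, Measure.restrict_restrict hmeas, hinter, setLIntegral_congr hae,
    setLIntegral_Ici_rpow hpos (by norm_num)]
  norm_num [Real.rpow_neg_one]

/-- The derivative in u of the lower tail telescopes to minus the mass at k; equivalently, the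
(k+1)-st arrival time has a Gamma density. -/
theorem poissonMeasure_Ici_succ (r : ℝ≥0) (k : ℕ) :
    poissonMeasure r (Set.Ici (k + 1)) =
      ∫⁻ u in Set.Ioc 0 (r : ℝ), poissonMeasure u.toNNReal {k} := by
  have hd : ∀ u : ℝ, HasDerivAt
      (fun u => -∑ j ∈ Finset.range (k + 1), Real.exp (-u) * u ^ j / j.factorial)
      (Real.exp (-u) * u ^ k / k.factorial) u := by
    intro u
    have hterm : ∀ j : ℕ, HasDerivAt (fun u => Real.exp (-u) * u ^ j / j.factorial)
        ((Real.exp (-u) * (-1) * u ^ j + Real.exp (-u) * (j * u ^ (j - 1))) / j.factorial) u :=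
      fun j => (((hasDerivAt_neg u).exp).mul (hasDerivAt_pow j u)).div_const _
    have := (HasDerivAt.fun_sum fun j (_ : j ∈ Finset.range (k + 1)) => hterm j).neg
    convert! this using 1
    clear this hterm
    induction k with
    | zero => simp
    | succ k ih =>
      rw [Finset.sum_range_succ, neg_add, ← ih, Nat.factorial_succ]
      push_cast
      have : (k.factorial : ℝ) ≠ 0 := by positivity
      have h2 : (k : ℝ) + 1 ≠ 0 := by positivity
      field_simp
      ring
  have hcont : Continuous fun u : ℝ => Real.exp (-u) * u ^ k / k.factorial := by fun_prop
  have hint := intervalIntegral.integral_eq_sub_of_hasDerivAt (a := 0) (b := r)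
    (fun u _ => hd u) (hcont.intervalIntegrable _ _)
  have h0 : ∑ j ∈ Finset.range (k + 1), Real.exp (-0) * (0 : ℝ) ^ j / j.factorial = 1 := by
    rw [Finset.sum_eq_single 0] <;> simp +contextual
  rw [h0] at hint
  have hlhs : (poissonMeasure r).real (Set.Ici (k + 1)) =
      1 - ∑ j ∈ Finset.range (k + 1), Real.exp (-r) * (r : ℝ) ^ j / j.factorial := by
    have hc : Set.Ici (k + 1) = ((Finset.range (k + 1) : Finset ℕ) : Set ℕ)ᶜ := by
      ext j; simp
    rw [hc, probReal_compl_eq_one_sub (.of_discrete), ← sum_measureReal_singleton]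
    simp only [poissonMeasure_real_singleton]
  rw [← ofReal_measureReal, hlhs]
  have hrw : ∀ u ∈ Set.Ioc 0 (r : ℝ), poissonMeasure u.toNNReal {k} =
      ENNReal.ofReal (Real.exp (-u) * u ^ k / k.factorial) := fun u hu => by
    rw [poissonMeasure_singleton, Real.coe_toNNReal _ hu.1.le]
  rw [setLIntegral_congr_fun measurableSet_Ioc hrw, ← ofReal_integral_eq_lintegral_ofReal,
    ← intervalIntegral.integral_of_le r.coe_nonneg, hint]
  · congr 1; ring
  · exact hcont.integrableOn_Icc.mono_set Set.Ioc_subset_Icc_self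
  · filter_upwards [ae_restrict_mem measurableSet_Ioc] with u hu
    have := hu.1.le
    positivity

theorem measurable_poissonMeasure_singleton (k : ℕ) :
    Measurable fun u : ℝ => poissonMeasure u.toNNReal {k} := by
  simp only [poissonMeasure_singleton]
  fun_prop

theorem poissonMeasure_Ici_eq_tsum (r : ℝ≥0) (n : ℕ) :
    poissonMeasure r (Set.Ici n) = ∑' k : ℕ, poissonMeasure r {n + k} := by
  have : Set.Ici n = ⋃ k : ℕ, {n + k} := by
    ext j
    simp only [Set.mem_Ici, Set.mem_iUnion, Set.mem_singleton_iff]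
    exact ⟨fun h => ⟨j - n, by omega⟩, by rintro ⟨k, rfl⟩; omega⟩
  rw [this, measure_iUnion _ fun _ => .of_discrete]
  intro j k hjk
  simpa using hjk

theorem lintegral_Ioi_lintegral_Ioc_swap {R : ℝ → ℝ} (hR : Measurable R) {G w : ℝ → ℝ≥0∞}
    (hG : Measurable G) (hw : Measurable w) :
    ∫⁻ t in Set.Ioi 0, (∫⁻ u in Set.Ioc 0 (R t), G u) * w t =
      ∫⁻ u in Set.Ioi 0, G u * ∫⁻ t in {t | u ≤ R t} ∩ Set.Ioi 0, w t := by
  have hT : MeasurableSet {z : ℝ × ℝ | z.2 ≤ R z.1} :=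
    measurableSet_le measurable_snd (hR.comp measurable_fst)
  let H : ℝ → ℝ → ℝ≥0∞ := fun t u => {z : ℝ × ℝ | z.2 ≤ R z.1}.indicator
    (fun z => G z.2 * w z.1) (t, u)
  have hH : Measurable (Function.uncurry H) :=
    ((hG.comp measurable_snd).mul (hw.comp measurable_fst)).indicator hT
  calc _ = ∫⁻ t in Set.Ioi 0, ∫⁻ u in Set.Ioi 0, H t u := by
        refine lintegral_congr fun t => ?_
        have : ∀ u, H t u = (Set.Iic (R t)).indicator (fun u => G u * w t) u := fun u => rfl
        simp only [this]
        rw [lintegral_indicator measurableSet_Iic, Measure.restrict_restrict measurableSet_Iic,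
          Set.inter_comm, Set.Ioi_inter_Iic, lintegral_mul_const _ hG]
    _ = ∫⁻ u in Set.Ioi 0, ∫⁻ t in Set.Ioi 0, H t u :=
        lintegral_lintegral_swap hH.aemeasurable
    _ = _ := by
        refine lintegral_congr fun u => ?_
        have hu : MeasurableSet {t | u ≤ R t} := measurableSet_le measurable_const hR
        have : ∀ t, H t u = {t | u ≤ R t}.indicator (fun t => G u * w t) t := fun u => rfl
        simp only [this]
        rw [lintegral_indicator hu, Measure.restrict_restrict hu, lintegral_const_mul _ hw]

/-- The mean of `∑ k > n, Z k ^ (-a)` for the arrival times `Z k` of a unit rate Poisson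
process, expressed through the counting distributions. -/
theorem lintegral_poissonMeasure_Ici_mul_rpow {n : ℕ} {a : ℝ} (ha : 1 < a) (hn : 1 ≤ n)
    (hna : a < n + 1) :
    ∫⁻ u in Set.Ioi (0 : ℝ), poissonMeasure u.toNNReal (Set.Ici n) * ENNReal.ofReal (u ^ (-a)) =
      ENNReal.ofReal ((a - 1)⁻¹ * (Real.Gamma (n + 1 - a) / Real.Gamma n)) := by
  obtain ⟨m, rfl⟩ : ∃ m, n = m + 1 := ⟨n - 1, by omega⟩
  have h1 : ∀ u ∈ Set.Ioi (0 : ℝ),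
      poissonMeasure u.toNNReal (Set.Ici (m + 1)) * ENNReal.ofReal (u ^ (-a)) =
      (∫⁻ v in Set.Ioc 0 u, poissonMeasure v.toNNReal {m}) * ENNReal.ofReal (u ^ (-a)) := by
    intro u hu
    rw [poissonMeasure_Ici_succ, Real.coe_toNNReal _ (Set.mem_Ioi.1 hu).le]
  rw [setLIntegral_congr_fun measurableSet_Ioi h1,
    lintegral_Ioi_lintegral_Ioc_swap (R := fun t => t) measurable_id (measurable_poissonMeasure_singleton m)
      (by fun_prop)]
  -- The inner integral is v^(1-a) / (a-1); with the Poisson mass at m = n - 1 it forms the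
  -- integrand of Γ(n + 1 - a).
  have h2 : ∀ v ∈ Set.Ioi (0 : ℝ), poissonMeasure v.toNNReal {m} *
      ∫⁻ t in {t | v ≤ t} ∩ Set.Ioi 0, ENNReal.ofReal (t ^ (-a)) =
      ENNReal.ofReal ((a - 1)⁻¹ / m.factorial) *
        ENNReal.ofReal (Real.exp (-v) * v ^ ((m + 2 - a) - 1)) := by
    intro v hv
    have hv : 0 < v := hv
    have hset : {t | v ≤ t} ∩ Set.Ioi 0 = Set.Ici v := by
      ext t
      simp only [Set.mem_inter_iff, Set.mem_ofPred_eq, Set.mem_Ioi, Set.mem_Ici]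
      exact ⟨fun h => h.1, fun h => ⟨h, hv.trans_le h⟩⟩
    have hrp : v ^ ((m + 2 - a) - 1 : ℝ) = v ^ m * v ^ (1 - a) := by
      rw [← Real.rpow_natCast, ← Real.rpow_add hv]; congr 1; ring
    have ha' : 0 < a - 1 := by linarith
    rw [hset, setLIntegral_Ici_rpow hv ha, poissonMeasure_singleton, Real.coe_toNNReal _ hv.le,
      ← ENNReal.ofReal_mul (by positivity), ← ENNReal.ofReal_mul (by positivity), hrp]
    congr 1
    field_simp
  have hs : 0 < (m : ℝ) + 2 - a := by push_cast at hna; linarith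
  have ha' : 0 < a - 1 := by linarith
  rw [setLIntegral_congr_fun measurableSet_Ioi h2, lintegral_const_mul' _ _ ENNReal.ofReal_ne_top,
    ← ofReal_integral_eq_lintegral_ofReal (Real.GammaIntegral_convergent hs),
    ← Real.Gamma_eq_integral hs, ← ENNReal.ofReal_mul (by positivity)]
  · push_cast
    rw [Real.Gamma_nat_eq_factorial, show (m : ℝ) + 1 + 1 - a = m + 2 - a by ring]
    congr 1
    ring
  · filter_upwards [ae_restrict_mem measurableSet_Ioi] with v hv
    have : 0 < v := hv
    positivity

theorem lintegral_poissonMeasure_Ici_succ_mul_rpow {c a : ℝ} (hc : 0 < c) (ha : 0 < a) (k : ℕ) :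
    ∫⁻ t in Set.Ioi (0 : ℝ), poissonMeasure (c * t ^ a⁻¹).toNNReal (Set.Ici (k + 1)) *
        ENNReal.ofReal (t ^ (-2 : ℝ)) =
      ENNReal.ofReal (c ^ a) * ∫⁻ u in Set.Ioi (0 : ℝ), poissonMeasure u.toNNReal {k} *
        ENNReal.ofReal (u ^ (-a)) := by
  have h1 : ∀ t ∈ Set.Ioi (0 : ℝ), poissonMeasure (c * t ^ a⁻¹).toNNReal (Set.Ici (k + 1)) *
        ENNReal.ofReal (t ^ (-2 : ℝ)) = (∫⁻ u in Set.Ioc 0 (c * t ^ a⁻¹),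
          poissonMeasure u.toNNReal {k}) * ENNReal.ofReal (t ^ (-2 : ℝ)) := by
    intro t ht
    have ht : 0 < t := ht
    rw [poissonMeasure_Ici_succ, Real.coe_toNNReal _ (by positivity)]
  rw [setLIntegral_congr_fun measurableSet_Ioi h1,
    lintegral_Ioi_lintegral_Ioc_swap (by fun_prop) (measurable_poissonMeasure_singleton k)
      (by fun_prop), ← lintegral_const_mul' _ _ ENNReal.ofReal_ne_top]
  refine setLIntegral_congr_fun measurableSet_Ioi fun u hu => ?_
  have hu : 0 < u := hu
  -- The mean c t^(1/a) reaches u at t = (u/c)^a, beyond which t^(-2) integrates to c^a u^(-a).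
  have hset : {t | u ≤ c * t ^ a⁻¹} ∩ Set.Ioi 0 = Set.Ici ((u / c) ^ a) := by
    ext t
    simp only [Set.mem_inter_iff, Set.mem_ofPred_eq, Set.mem_Ioi, Set.mem_Ici]
    rw [← div_le_iff₀' hc]
    have hb : 0 < (u / c) ^ a := by positivity
    constructor
    · rintro ⟨h, ht⟩
      exact (Real.le_rpow_inv_iff_of_pos (by positivity) ht.le ha).1 h
    · intro h
      exact ⟨(Real.le_rpow_inv_iff_of_pos (by positivity) (hb.le.trans h) ha).2 h, hb.trans_le h⟩
  rw [hset, setLIntegral_Ici_rpow (by positivity) (by norm_num), mul_left_comm,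
    ← ENNReal.ofReal_mul (by positivity)]
  congr 2
  rw [show (1 - 2 : ℝ) = -1 by norm_num, Real.rpow_neg_one, Real.div_rpow hu.le hc.le,
    Real.rpow_neg hu.le]
  norm_num
  rw [div_eq_mul_inv]

theorem poissonMeasure_Ici_succ_le (r : ℝ) (k : ℕ) :
    poissonMeasure r.toNNReal (Set.Ici (k + 1)) ≤ ENNReal.ofReal r := by
  rw [poissonMeasure_Ici_succ]
  refine (lintegral_mono (g := fun _ => 1) fun u => prob_le_one).trans ?_
  simp

theorem tendsto_poissonMeasure_Iio (k : ℕ) :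
    Tendsto (fun r : ℝ => poissonMeasure r.toNNReal (Set.Iio k)) atTop (𝓝 0) := by
  have h1 : ∀ r : ℝ, poissonMeasure r.toNNReal (Set.Iio k) =
      ∑ j ∈ Finset.range k, poissonMeasure r.toNNReal {j} := fun r => by
    rw [sum_measure_singleton]
    congr 1
    ext j; simp
  simp only [h1]
  rw [← Finset.sum_const_zero (s := Finset.range k)]
  refine tendsto_finsetSum _ fun j _ => ?_
  have h2 : Tendsto (fun r : ℝ => ENNReal.ofReal (r ^ j * Real.exp (-r) / j.factorial)) atTop
      (𝓝 0) := by
    have := (Real.tendsto_pow_mul_exp_neg_atTop_nhds_zero j).div_const (j.factorial : ℝ)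
    rw [zero_div] at this
    simpa using ENNReal.tendsto_ofReal this
  refine h2.congr' ?_
  filter_upwards [eventually_ge_atTop 0] with r hr
  rw [poissonMeasure_singleton, Real.coe_toNNReal _ hr, mul_comm]

/-- Layer-cake formula for the inverse of the first time at which a counting process with Poisson
marginals reaches a level. -/
theorem ae_ofReal_inv_sInf_eq_lintegral {Ω : Type*} [MeasurableSpace Ω] {P : Measure Ω}
    {N : ℝ → Ω → ℕ∞} (hmono : Monotone N) {c b : ℝ} (hc : 0 < c) (hb : 0 < b)
    (hlaw : ∀ t, 0 ≤ t →
      HasLaw (N t) ((poissonMeasure (c * t ^ b).toNNReal).map (Nat.cast : ℕ → ℕ∞)) P) (k : ℕ) :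
    ∀ᵐ ω ∂P, ENNReal.ofReal (sInf {t | ((k + 1 : ℕ) : ℕ∞) ≤ N t ω})⁻¹ =
      ∫⁻ t in Set.Ioi 0, {t | ((k + 1 : ℕ) : ℕ∞) ≤ N t ω}.indicator
        (fun t => ENNReal.ofReal (t ^ (-2 : ℝ))) t := by
  have hP : ∀ t, 0 ≤ t → ∀ B : Set ℕ∞, P {ω | N t ω ∈ B} =
      poissonMeasure (c * t ^ b).toNNReal (Nat.cast ⁻¹' B) := fun t ht B => by
    rw [(hlaw t ht).measure_eq (p := fun N => N ∈ B) .of_discrete]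
    exact Measure.map_apply .of_discrete .of_discrete
  -- Never reaching level k + 1 implies N(t) ≤ k for every t, and that probability tends to 0 as t
  -- grows.
  have hlarge : ∀ᵐ ω ∂P, ∃ t, ((k + 1 : ℕ) : ℕ∞) ≤ N t ω := by
    rw [ae_iff]
    push Not
    have hlim : Tendsto (fun t : ℝ => poissonMeasure (c * t ^ b).toNNReal (Set.Iio (k + 1)))
        atTop (𝓝 0) :=
      (tendsto_poissonMeasure_Iio (k + 1)).comp ((tendsto_rpow_atTop hb).const_mul_atTop hc)
    refine le_antisymm (ge_of_tendsto hlim ?_) zero_le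
    filter_upwards [eventually_ge_atTop 0] with t ht
    have h1 : Set.Iio (k + 1) = (Nat.cast ⁻¹' Set.Iio ((k + 1 : ℕ) : ℕ∞) : Set ℕ) := by
      ext j; simp only [Set.mem_Iio, Set.mem_preimage, Nat.cast_lt]
    rw [h1, ← hP t ht]
    exact measure_mono fun ω hω => hω t
  -- Having k + 1 points at every positive t has probability at most c t^b, which tends to 0 with t;
  -- this keeps the infimum positive.
  have hsmall : ∀ᵐ ω ∂P, ∃ ε, 0 < ε ∧ ¬ ((k + 1 : ℕ) : ℕ∞) ≤ N ε ω := by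
    rw [ae_iff]
    push Not
    have hlim : Tendsto (fun t : ℝ => ENNReal.ofReal (c * t ^ b)) (𝓝[>] 0) (𝓝 0) := by
      have : Tendsto (fun t : ℝ => ENNReal.ofReal (c * t ^ b)) (𝓝 0) (𝓝 0) := by
        have h := (Real.continuousAt_rpow_const 0 b (Or.inr hb.le)).tendsto.const_mul c
        rw [Real.zero_rpow hb.ne', mul_zero] at h
        simpa using ENNReal.tendsto_ofReal h
      exact this.mono_left nhdsWithin_le_nhds
    refine le_antisymm (ge_of_tendsto hlim ?_) zero_le
    filter_upwards [self_mem_nhdsWithin] with t ht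
    have ht : 0 < t := ht
    refine le_trans ?_ (poissonMeasure_Ici_succ_le _ k)
    have h1 : Set.Ici (k + 1) = (Nat.cast ⁻¹' Set.Ici ((k + 1 : ℕ) : ℕ∞) : Set ℕ) := by
      ext j; simp only [Set.mem_Ici, Set.mem_preimage, Nat.cast_le]
    rw [h1, ← hP t ht.le]
    exact measure_mono fun ω hω => hω t ht
  filter_upwards [hlarge, hsmall] with ω hω1 ⟨ε, hε, hω2⟩
  exact ofReal_inv_sInf_eq_lintegral (fun s t hst hs => le_trans hs (hmono hst ω)) hω1 hε hω2

theorem lintegral_indicator_count {Ω : Type*} [MeasurableSpace Ω] {P : Measure Ω} [SFinite P]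
    {N : ℝ → Ω → ℕ∞} (hN : Measurable fun z : Ω × ℝ => N z.2 z.1) {c b : ℝ}
    (hlaw : ∀ t, 0 ≤ t →
      HasLaw (N t) ((poissonMeasure (c * t ^ b).toNNReal).map (Nat.cast : ℕ → ℕ∞)) P) (k : ℕ) :
    Measurable (fun ω => ∫⁻ t in Set.Ioi 0, {t | (k : ℕ∞) ≤ N t ω}.indicator
        (fun t => ENNReal.ofReal (t ^ (-2 : ℝ))) t) ∧
      ∫⁻ ω, (∫⁻ t in Set.Ioi 0, {t | (k : ℕ∞) ≤ N t ω}.indicator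
        (fun t => ENNReal.ofReal (t ^ (-2 : ℝ))) t) ∂P =
      ∫⁻ t in Set.Ioi (0 : ℝ), poissonMeasure (c * t ^ b).toNNReal (Set.Ici k) *
        ENNReal.ofReal (t ^ (-2 : ℝ)) := by
  have hm : Measurable (Function.uncurry fun (ω : Ω) (t : ℝ) => {t | (k : ℕ∞) ≤ N t ω}.indicator
      (fun t => ENNReal.ofReal (t ^ (-2 : ℝ))) t) := by
    have h1 : Measurable fun z : Ω × ℝ => ENNReal.ofReal (z.2 ^ (-2 : ℝ)) := by fun_prop
    exact h1.indicator (hN (.of_discrete (s := Set.Ici (k : ℕ∞))))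
  refine ⟨hm.lintegral_prod_right', ?_⟩
  rw [lintegral_lintegral_swap hm.aemeasurable]
  refine setLIntegral_congr_fun measurableSet_Ioi fun t ht => ?_
  have ht : 0 < t := ht
  have hset : MeasurableSet {ω | (k : ℕ∞) ≤ N t ω} :=
    (hN.comp measurable_prodMk_right) (.of_discrete (s := Set.Ici (k : ℕ∞)))
  have h1 : ∀ ω, {t | (k : ℕ∞) ≤ N t ω}.indicator (fun t => ENNReal.ofReal (t ^ (-2 : ℝ))) t =
      {ω | (k : ℕ∞) ≤ N t ω}.indicator (fun _ => ENNReal.ofReal (t ^ (-2 : ℝ))) ω := fun ω => rfl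
  simp only [h1]
  rw [lintegral_indicator_const hset, mul_comm,
    (hlaw t ht.le).measure_eq (p := fun N => (k : ℕ∞) ≤ N) .of_discrete,
    Measure.map_apply .of_discrete .of_discrete]
  congr 2
  ext j; simp

/-! ### The mean of the partial interference. -/

theorem mainTheorem5 {Ω : Type*} [MeasurableSpace Ω] (P : Measure Ω) [IsProbabilityMeasure P]
    (α φ lam : ℝ) (hα : 2 < α) (hφ_pos : 0 < φ) (hφ_le : φ ≤ 2 * Real.pi) (hlam : 0 < lam)
    (x : Plane)
    (X : ℕ → Ω → Plane)
    (hX : IsPoissonPointProcess X (ENNReal.ofReal lam • (volume : Measure Plane)) P)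
    (h : ℕ → Ω → ℝ)
    (h_meas : ∀ i, Measurable (h i))
    (h_pos : ∀ i, ∀ᵐ ω ∂P, 0 < h i ω)
    (h_indep : iIndepFun h P)
    (h_ident : ∀ i, IdentDistrib (h i) (h 0) P P)
    (h_moment : Integrable (fun ω => h 0 ω ^ (2 / α)) P)
    (hXh : IndepFun (fun ω i => X i ω) (fun ω i => h i ω) P)
    (n : ℕ) (hn : 1 ≤ n) (hnα : α / 2 < n + 1) :
    AEMeasurable
        (fun ω => partialInterference α φ x (fun i => X i ω) (fun i => h i ω) n) P ∧
      ∫⁻ ω, partialInterference α φ x (fun i => X i ω) (fun i => h i ω) n ∂P =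
        ENNReal.ofReal
          (2 / (α - 2) * ((∫ ω, h 0 ω ^ (2 / α) ∂P) * φ * lam / 2) ^ (α / 2) *
            (Real.Gamma (n + 1 - α / 2) / Real.Gamma n)) := by
  have hα0 : 0 < α := by linarith
  set c : ℝ := (∫ ω, h 0 ω ^ (2 / α) ∂P) * φ * lam / 2 with hc_def
  -- Positive gains make c > 0, so that N(t) grows without bound and the mean can be rescaled to u.
  have hI : 0 < ∫ ω, h 0 ω ^ (2 / α) ∂P := by
    have hp : ∀ᵐ ω ∂P, 0 < h 0 ω ^ (2 / α) := (h_pos 0).mono fun ω hω => Real.rpow_pos_of_pos hω _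
    rw [integral_pos_iff_support_of_nonneg_ae (hp.mono fun ω hω => hω.le) h_moment]
    have : Function.support (fun ω => h 0 ω ^ (2 / α)) =ᵐ[P] Set.univ :=
      eventuallyEq_univ.2 (hp.mono fun ω hω => hω.ne')
    rw [measure_congr this]
    simp
  have hc : 0 < c := by positivity
  let N : ℝ → Ω → ℕ∞ := fun t => pointCount (fun i ω => (X i ω, h i ω)) (heardRegion α φ x t)
  have hmono : Monotone N := fun s t hst ω =>
    Set.encard_le_encard fun i hi => ⟨hi.1, hi.2.trans hst⟩
  have hN : Measurable fun z : Ω × ℝ => N z.2 z.1 := by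
    refine measurable_encard.comp (measurable_set_iff.2 fun i => measurable_mem.2 ?_)
    exact (measurable_snd.prodMk (((hX.measurable_point i).comp measurable_fst).prodMk
      ((h_meas i).comp measurable_fst))) (measurableSet_heardRegion_prod α φ x)
  have hlaw : ∀ t, 0 ≤ t → HasLaw (N t)
      ((poissonMeasure (c * t ^ (α / 2)⁻¹).toNNReal).map (Nat.cast : ℕ → ℕ∞)) P := by
    intro t ht
    have := Measure.isProbabilityMeasure_map (μ := P) (h_meas 0).aemeasurable
    have hrpow : Measurable fun m : ℝ => m ^ (2 / α) := by fun_prop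
    have hmass := prod_heardRegion (lam := lam) hα0 hφ_pos hφ_le x (P.map (h 0))
      ((ae_map_iff (h_meas 0).aemeasurable measurableSet_Ioi).2 (h_pos 0))
      ((integrable_map_measure hrpow.aestronglyMeasurable (h_meas 0).aemeasurable).2 h_moment) ht
    rw [integral_map (h_meas 0).aemeasurable hrpow.aestronglyMeasurable, ← hc_def, ← inv_div]
      at hmass
    have := hX.hasLaw_pointCount_mark h_meas h_indep h_ident hXh
      (measurableSet_heardRegion α φ x t) (by rw [hmass]; exact ENNReal.ofReal_ne_top)
    rwa [hmass] at this
  have hcount := fun k => lintegral_indicator_count hN hlaw k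
  have hae : (fun ω => partialInterference α φ x (fun i => X i ω) (fun i => h i ω) n) =ᵐ[P]
      fun ω => ∑' k : ℕ, ∫⁻ t in Set.Ioi 0, {t | ((n + k + 1 : ℕ) : ℕ∞) ≤ N t ω}.indicator
        (fun t => ENNReal.ofReal (t ^ (-2 : ℝ))) t := by
    filter_upwards [ae_all_iff.2 fun k =>
      ae_ofReal_inv_sInf_eq_lintegral hmono hc (by positivity) hlaw (n + k)] with ω hω
    simp only [← hω]
    refine tsum_congr fun k => ?_
    rw [add_right_comm]
    rfl
  have hmeas : ∀ k : ℕ, AEMeasurable (fun ω => ∫⁻ t in Set.Ioi 0,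
      {t | ((n + k + 1 : ℕ) : ℕ∞) ≤ N t ω}.indicator
        (fun t => ENNReal.ofReal (t ^ (-2 : ℝ))) t) P := fun k => (hcount _).1.aemeasurable
  refine ⟨(AEMeasurable.tsum hmeas).congr hae.symm, ?_⟩
  rw [lintegral_congr_ae hae, lintegral_tsum hmeas]
  simp only [(hcount _).2, lintegral_poissonMeasure_Ici_succ_mul_rpow hc (half_pos hα0)]
  have hmeas' : ∀ k : ℕ, Measurable fun u : ℝ =>
      poissonMeasure u.toNNReal {n + k} * ENNReal.ofReal (u ^ (-(α / 2))) := fun k =>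
    (measurable_poissonMeasure_singleton _).mul (by fun_prop)
  -- Summing under the integral over u collects the masses at n + k into the Poisson tail from n.
  rw [ENNReal.tsum_mul_left, ← lintegral_tsum fun k => (hmeas' k).aemeasurable]
  simp only [ENNReal.tsum_mul_right, ← poissonMeasure_Ici_eq_tsum]
  rw [lintegral_poissonMeasure_Ici_mul_rpow (by linarith) hn hnα,
    ← ENNReal.ofReal_mul (by positivity)]
  congr 1
  have : α - 2 ≠ 0 := by linarith
  have : α / 2 - 1 ≠ 0 := by linarith
  field_simp

end
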